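/- Let $M$ be a complex manifold with complex structure $J$, and let $g$ be a Kähler metric on $M$, i.e. a smooth Riemannian metric with $g(Ju,Jv)=g(u,v)$ whose Kähler form $\omega(u,v)=g(Ju,v)$ is closed. Suppose that $M$ carries a special Kähler structure: a smooth connection $\nabla$ on the real tangent bundle $TM$ which is flat, torsion-free and symplectic ($\nabla\omega=0$), and which satisfies $d_\nabla J=0$, where $J$ is regarded as a $1$-form with values in $TM$, i.e. $\nabla_X(JY)-\nabla_Y(JX)-J[X,Y]=0$ for all vector fields $X,Y$. Then the Ricci curvature of $g$ is nonnegative: $\mathrm{Ric}(v,v)\ge 0$ for every tangent vector $v$. Moreover, if the scalar curvature of $g$ vanishes identically on $M$, then the Riemann curvature tensor of $g$ vanishes identically on $M$. -/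

import Mathlib

open Bundle VectorField
open scoped Manifold ContDiff

noncomputable section

set_option linter.unusedSectionVars false

namespace SpecialKahler

/-! ## Riemannian geometry of a smooth manifold modelled on a real vector space -/

section Real

variable {E : Type*} [NormedAddCommGroup E] [NormedSpace ℝ E] [FiniteDimensional ℝ E]
  {M : Type*} [TopologicalSpace M] [ChartedSpace E M] [IsManifold 𝓘(ℝ, E) ∞ M]

instance instFiniteDimensionalTangentSpace (x : M) : FiniteDimensional ℝ (TangentSpace 𝓘(ℝ, E) x) :=
  inferInstanceAs (FiniteDimensional ℝ E)

/-- Differentiability of a vector field, as a section of the real tangent bundle, at a point. -/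
def DiffAt (X : Π x : M, TangentSpace 𝓘(ℝ, E) x) (x : M) : Prop :=
  MDiffAt (T% X) x

/-- The curvature operator `R(X, Y) Z = ∇_X ∇_Y Z - ∇_Y ∇_X Z - ∇_[X,Y] Z` of a connection on the
tangent bundle, on vector fields. (In Mathlib's notation, `∇_X Z` at `x` is `cov Z x (X x)`.) -/
def curvatureField (cov : CovariantDerivative 𝓘(ℝ, E) E (fun x : M ↦ TangentSpace 𝓘(ℝ, E) x))
    (X Y Z : Π x : M, TangentSpace 𝓘(ℝ, E) x) (x : M) : TangentSpace 𝓘(ℝ, E) x :=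
  cov (fun y ↦ cov Z y (Y y)) x (X x) - cov (fun y ↦ cov Z y (X y)) x (Y x)
    - cov Z x (mlieBracket 𝓘(ℝ, E) X Y x)

/-- The curvature tensor `R(u, v) w` at a point, computed with the extensions of the three tangent
vectors that are constant in the preferred chart at that point. For a smooth connection the result
is independent of the choice of smooth extensions. -/
def curvature (cov : CovariantDerivative 𝓘(ℝ, E) E (fun x : M ↦ TangentSpace 𝓘(ℝ, E) x))
    (x : M) (u v w : TangentSpace 𝓘(ℝ, E) x) : TangentSpace 𝓘(ℝ, E) x :=
  curvatureField cov (FiberBundle.extend E u) (FiberBundle.extend E v) (FiberBundle.extend E w) x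

variable [RiemannianBundle (fun x : M ↦ TangentSpace 𝓘(ℝ, E) x)]

/-- The right-hand side of the Koszul formula for `g(∇_X Y, Z)`. -/
def koszul (X Y Z : Π x : M, TangentSpace 𝓘(ℝ, E) x) (x : M) : ℝ :=
  (1 / 2 : ℝ) *
    (mvfderiv 𝓘(ℝ, E) (fun y ↦ inner ℝ (Y y) (Z y)) x (X x)
      + mvfderiv 𝓘(ℝ, E) (fun y ↦ inner ℝ (Z y) (X y)) x (Y x)
      - mvfderiv 𝓘(ℝ, E) (fun y ↦ inner ℝ (X y) (Y y)) x (Z x)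
      + inner ℝ (mlieBracket 𝓘(ℝ, E) X Y x) (Z x)
      - inner ℝ (mlieBracket 𝓘(ℝ, E) X Z x) (Y x)
      - inner ℝ (mlieBracket 𝓘(ℝ, E) Y Z x) (X x))

variable [CompleteSpace E]
  [IsContMDiffRiemannianBundle 𝓘(ℝ, E) ∞ E (fun x : M ↦ TangentSpace 𝓘(ℝ, E) x)]

theorem mdifferentiableAt_inner {x : M} {Y Z : Π x : M, TangentSpace 𝓘(ℝ, E) x}
    (hY : MDiffAt (T% Y) x) (hZ : MDiffAt (T% Z) x) :
    MDiffAt (fun y ↦ inner ℝ (Y y) (Z y)) x :=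
  MDifferentiableAt.inner_bundle (IB := 𝓘(ℝ, E)) (F := E)
    (E := fun x : M ↦ TangentSpace 𝓘(ℝ, E) x) (b := fun y ↦ y) (v := Y) (w := Z) hY hZ

theorem tensorialAt_koszul_left {x : M} {Y Z : Π x : M, TangentSpace 𝓘(ℝ, E) x}
    (hY : MDiffAt (T% Y) x) (hZ : MDiffAt (T% Z) x) :
    TensorialAt 𝓘(ℝ, E) E (fun X ↦ koszul X Y Z x) x where
  smul {f X} hf hX := by
    have e1 : (fun y ↦ inner ℝ (Z y) ((f • X) y)) = fun y ↦ f y * inner ℝ (Z y) (X y) := by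
      ext y; simp [inner_smul_right]
    have e2 : (fun y ↦ inner ℝ ((f • X) y) (Y y)) = fun y ↦ f y * inner ℝ (X y) (Y y) := by
      ext y; simp [inner_smul_left]
    simp only [koszul, e1, e2]
    rw [mvfderiv_fun_mul hf (mdifferentiableAt_inner hZ hX), mvfderiv_fun_mul hf (mdifferentiableAt_inner hX hY),
      mlieBracket_smul_left hf hX, mlieBracket_smul_left hf hX]
    simp [inner_add_left, inner_smul_left, inner_smul_right, real_inner_comm]
    ring
  add {X X'} hX hX' := by
    have e1 : (fun y ↦ inner ℝ (Z y) ((X + X') y))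
        = fun y ↦ inner ℝ (Z y) (X y) + inner ℝ (Z y) (X' y) := by
      ext y; simp [inner_add_right]
    have e2 : (fun y ↦ inner ℝ ((X + X') y) (Y y))
        = fun y ↦ inner ℝ (X y) (Y y) + inner ℝ (X' y) (Y y) := by
      ext y; simp [inner_add_left]
    simp only [koszul, e1, e2]
    rw [mvfderiv_fun_add (mdifferentiableAt_inner hZ hX) (mdifferentiableAt_inner hZ hX'),
      mvfderiv_fun_add (mdifferentiableAt_inner hX hY) (mdifferentiableAt_inner hX' hY),
      mlieBracket_add_left hX hX', mlieBracket_add_left hX hX']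
    simp [inner_add_left, inner_add_right]
    ring

theorem tensorialAt_koszul_right {x : M} {X Y : Π x : M, TangentSpace 𝓘(ℝ, E) x}
    (hX : MDiffAt (T% X) x) (hY : MDiffAt (T% Y) x) :
    TensorialAt 𝓘(ℝ, E) E (fun Z ↦ koszul X Y Z x) x where
  smul {f Z} hf hZ := by
    have e1 : (fun y ↦ inner ℝ ((f • Z) y) (X y)) = fun y ↦ f y * inner ℝ (Z y) (X y) := by
      ext y; simp [inner_smul_left]
    have e2 : (fun y ↦ inner ℝ (Y y) ((f • Z) y)) = fun y ↦ f y * inner ℝ (Y y) (Z y) := by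
      ext y; simp [inner_smul_right]
    simp only [koszul, e1, e2]
    rw [mvfderiv_fun_mul hf (mdifferentiableAt_inner hZ hX), mvfderiv_fun_mul hf (mdifferentiableAt_inner hY hZ),
      mlieBracket_smul_right hf hZ, mlieBracket_smul_right hf hZ]
    simp [inner_add_left, inner_smul_left, inner_smul_right, real_inner_comm]
    ring
  add {Z Z'} hZ hZ' := by
    have e1 : (fun y ↦ inner ℝ ((Z + Z') y) (X y))
        = fun y ↦ inner ℝ (Z y) (X y) + inner ℝ (Z' y) (X y) := by
      ext y; simp [inner_add_left]
    have e2 : (fun y ↦ inner ℝ (Y y) ((Z + Z') y))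
        = fun y ↦ inner ℝ (Y y) (Z y) + inner ℝ (Y y) (Z' y) := by
      ext y; simp [inner_add_right]
    simp only [koszul, e1, e2]
    rw [mvfderiv_fun_add (mdifferentiableAt_inner hZ hX) (mdifferentiableAt_inner hZ' hX),
      mvfderiv_fun_add (mdifferentiableAt_inner hY hZ) (mdifferentiableAt_inner hY hZ'),
      mlieBracket_add_right hZ hZ', mlieBracket_add_right hZ hZ']
    simp [inner_add_left, inner_add_right]
    ring

/-- The Koszul form `(u, w) ↦ g(∇_u Y, w)` at a point where `Y` is differentiable. -/
def koszulForm {x : M} {Y : Π x : M, TangentSpace 𝓘(ℝ, E) x} (hY : MDiffAt (T% Y) x) :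
    TangentSpace 𝓘(ℝ, E) x →L[ℝ] TangentSpace 𝓘(ℝ, E) x →L[ℝ] ℝ :=
  TensorialAt.mkHom₂ (fun X Z ↦ koszul X Y Z x) x
    (fun _ hZ ↦ tensorialAt_koszul_left hY hZ) (fun _ hX ↦ tensorialAt_koszul_right hX hY)

theorem koszulForm_apply {x : M} {X Y Z : Π x : M, TangentSpace 𝓘(ℝ, E) x}
    (hX : MDiffAt (T% X) x) (hY : MDiffAt (T% Y) x) (hZ : MDiffAt (T% Z) x) :
    koszulForm hY (X x) (Z x) = koszul X Y Z x :=
  TensorialAt.mkHom₂_apply _ _ hX hZ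

/-- A `g`-orthonormal basis of the tangent space at `x`. -/
def orthoFrame (x : M) :
    OrthonormalBasis (Fin (Module.finrank ℝ (TangentSpace 𝓘(ℝ, E) x))) ℝ (TangentSpace 𝓘(ℝ, E) x) :=
  stdOrthonormalBasis ℝ (TangentSpace 𝓘(ℝ, E) x)

/-- The endomorphism `A` of the tangent space with `g(A u, w) = B u w`. -/
def raiseIndex {x : M}
    (B : TangentSpace 𝓘(ℝ, E) x →L[ℝ] TangentSpace 𝓘(ℝ, E) x →L[ℝ] ℝ) :
    TangentSpace 𝓘(ℝ, E) x →L[ℝ] TangentSpace 𝓘(ℝ, E) x :=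
  ∑ i, (B.flip (orthoFrame x i)).smulRight (orthoFrame x i)

theorem inner_raiseIndex {x : M}
    (B : TangentSpace 𝓘(ℝ, E) x →L[ℝ] TangentSpace 𝓘(ℝ, E) x →L[ℝ] ℝ)
    (u w : TangentSpace 𝓘(ℝ, E) x) : inner ℝ (raiseIndex B u) w = B u w := by
  conv_rhs => rw [← (orthoFrame x).sum_repr' w]
  simp [raiseIndex, sum_inner, inner_smul_left, mul_comm]

theorem koszul_add_middle {x : M} {X Y Y' Z : Π x : M, TangentSpace 𝓘(ℝ, E) x}
    (hX : MDiffAt (T% X) x) (hY : MDiffAt (T% Y) x) (hY' : MDiffAt (T% Y') x)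
    (hZ : MDiffAt (T% Z) x) : koszul X (Y + Y') Z x = koszul X Y Z x + koszul X Y' Z x := by
  have e1 : (fun y ↦ inner ℝ ((Y + Y') y) (Z y))
      = fun y ↦ inner ℝ (Y y) (Z y) + inner ℝ (Y' y) (Z y) := by
    ext y; simp [inner_add_left]
  have e2 : (fun y ↦ inner ℝ (X y) ((Y + Y') y))
      = fun y ↦ inner ℝ (X y) (Y y) + inner ℝ (X y) (Y' y) := by
    ext y; simp [inner_add_right]
  simp only [koszul, e1, e2]
  rw [mvfderiv_fun_add (mdifferentiableAt_inner hY hZ) (mdifferentiableAt_inner hY' hZ),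
    mvfderiv_fun_add (mdifferentiableAt_inner hX hY) (mdifferentiableAt_inner hX hY'),
    mlieBracket_add_right hY hY', mlieBracket_add_left hY hY']
  simp [inner_add_left, inner_add_right]
  ring

theorem koszul_smul_middle {x : M} {f : M → ℝ} {X Y Z : Π x : M, TangentSpace 𝓘(ℝ, E) x}
    (hf : MDiffAt f x) (hX : MDiffAt (T% X) x) (hY : MDiffAt (T% Y) x)
    (hZ : MDiffAt (T% Z) x) :
    koszul X (f • Y) Z x
      = f x * koszul X Y Z x + mvfderiv 𝓘(ℝ, E) f x (X x) * inner ℝ (Y x) (Z x) := by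
  have e1 : (fun y ↦ inner ℝ ((f • Y) y) (Z y)) = fun y ↦ f y * inner ℝ (Y y) (Z y) := by
    ext y; simp [inner_smul_left]
  have e2 : (fun y ↦ inner ℝ (X y) ((f • Y) y)) = fun y ↦ f y * inner ℝ (X y) (Y y) := by
    ext y; simp [inner_smul_right]
  simp only [koszul, e1, e2]
  rw [mvfderiv_fun_mul hf (mdifferentiableAt_inner hY hZ),
    mvfderiv_fun_mul hf (mdifferentiableAt_inner hX hY),
    mlieBracket_smul_right hf hY, mlieBracket_smul_left hf hY]
  simp [inner_add_left, inner_smul_left, inner_smul_right, real_inner_comm]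
  ring

open Classical in
/-- The Levi-Civita derivative of a vector field, determined by the Koszul formula
(and zero at points where the vector field is not differentiable). -/
def leviCivitaFun (Y : Π x : M, TangentSpace 𝓘(ℝ, E) x) (x : M) :
    TangentSpace 𝓘(ℝ, E) x →L[ℝ] TangentSpace 𝓘(ℝ, E) x :=
  if hY : MDiffAt (T% Y) x then raiseIndex (koszulForm hY) else 0

theorem inner_leviCivitaFun {x : M} {X Y Z : Π x : M, TangentSpace 𝓘(ℝ, E) x}
    (hX : MDiffAt (T% X) x) (hY : MDiffAt (T% Y) x) (hZ : MDiffAt (T% Z) x) :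
    inner ℝ (leviCivitaFun Y x (X x)) (Z x) = koszul X Y Z x := by
  rw [leviCivitaFun, dif_pos hY, inner_raiseIndex, koszulForm_apply hX hY hZ]

theorem ext_of_extend {x : M} {A B : TangentSpace 𝓘(ℝ, E) x →L[ℝ] TangentSpace 𝓘(ℝ, E) x}
    (h : ∀ X Z : Π x : M, TangentSpace 𝓘(ℝ, E) x, MDiffAt (T% X) x → MDiffAt (T% Z) x →
      inner ℝ (A (X x)) (Z x) = inner ℝ (B (X x)) (Z x)) : A = B := by
  ext u
  refine ext_inner_right ℝ fun w ↦ ?_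
  simpa using h (FiberBundle.extend E u) (FiberBundle.extend E w)
    (FiberBundle.mdifferentiableAt_extend ..) (FiberBundle.mdifferentiableAt_extend ..)

variable (E M) in
/-- The Levi-Civita connection of the Riemannian metric. -/
def leviCivita : CovariantDerivative 𝓘(ℝ, E) E (fun x : M ↦ TangentSpace 𝓘(ℝ, E) x) where
  toFun := leviCivitaFun
  isCovariantDerivativeOnUniv :=
    { add := fun {Y Y' x} hY hY' _ ↦ ext_of_extend fun X Z hX hZ ↦ by
        have h := mdifferentiableAt_add_section hY hY'
        rw [inner_leviCivitaFun hX h hZ, koszul_add_middle hX hY hY' hZ,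
          add_apply, inner_add_left, inner_leviCivitaFun hX hY hZ,
          inner_leviCivitaFun hX hY' hZ]
      leibniz := fun {Y f x} hY hf _ ↦ ext_of_extend fun X Z hX hZ ↦ by
        have h := hf.smul_section hY
        rw [inner_leviCivitaFun hX h hZ, koszul_smul_middle hf hX hY hZ,
          add_apply, inner_add_left, smul_apply,
          real_inner_smul_left, inner_leviCivitaFun hX hY hZ,
          ContinuousLinearMap.smulRight_apply, real_inner_smul_left] }

/-- The Levi-Civita connection is torsion-free. -/
theorem leviCivita_torsion : (leviCivita E M).torsion = 0 := by
  rw [CovariantDerivative.torsion_eq_zero_iff]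
  intro X Y x hX hY
  refine ext_inner_right ℝ fun w ↦ ?_
  have hZ : MDiffAt (T% (FiberBundle.extend E w)) x := FiberBundle.mdifferentiableAt_extend ..
  have h1 := inner_leviCivitaFun hX hY hZ
  have h2 := inner_leviCivitaFun hY hX hZ
  rw [FiberBundle.extend_apply_self] at h1 h2
  rw [inner_sub_left]
  refine (congrArg₂ (· - ·) h1 h2).trans ?_
  simp only [koszul, FiberBundle.extend_apply_self, mlieBracket_swap_apply (V := Y) (W := X),
    real_inner_comm, inner_neg_left]
  ring

/-- The Levi-Civita connection is compatible with the metric. -/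
theorem leviCivita_metric {x : M} {X Y Z : Π x : M, TangentSpace 𝓘(ℝ, E) x}
    (hX : MDiffAt (T% X) x) (hY : MDiffAt (T% Y) x) (hZ : MDiffAt (T% Z) x) :
    mvfderiv 𝓘(ℝ, E) (fun y ↦ inner ℝ (Y y) (Z y)) x (X x)
      = inner ℝ (leviCivita E M Y x (X x)) (Z x) + inner ℝ (Y x) (leviCivita E M Z x (X x)) := by
  have h1 := inner_leviCivitaFun hX hY hZ
  have h2 := inner_leviCivitaFun hX hZ hY
  rw [real_inner_comm (leviCivita E M Z x (X x))]
  refine Eq.trans ?_ (congrArg₂ (· + ·) h1 h2).symm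
  simp only [koszul, mlieBracket_swap_apply (V := Z) (W := Y), real_inner_comm, inner_neg_left]
  ring

variable (E) in
/-- The Riemann curvature tensor `R(u, v) w` of the metric. -/
def riemann (x : M) (u v w : TangentSpace 𝓘(ℝ, E) x) : TangentSpace 𝓘(ℝ, E) x :=
  curvature (leviCivita E M) x u v w

variable (E) in
/-- The Ricci tensor `Ric(v, w) = ∑ i, g(R(e_i, v) w, e_i)`, the trace of `u ↦ R(u, v) w`. -/
def ricci (x : M) (v w : TangentSpace 𝓘(ℝ, E) x) : ℝ :=
  ∑ i, inner ℝ (riemann E x (orthoFrame x i) v w) (orthoFrame x i)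

variable (E) in
/-- The scalar curvature, the trace of the Ricci tensor with respect to the metric. -/
def scalarCurvature (x : M) : ℝ :=
  ∑ i, ricci E x (orthoFrame x i) (orthoFrame x i)

end Real

/-! ## Kähler manifolds and special Kähler structures -/

section Complex

variable {E : Type*} [NormedAddCommGroup E] [NormedSpace ℂ E]
  {M : Type*} [TopologicalSpace M] [ChartedSpace E M]

/-- A finite-dimensional complex normed space is complete. -/
instance (priority := low) instCompleteSpaceOfFiniteDimensional [FiniteDimensional ℂ E] :
    CompleteSpace E :=
  FiniteDimensional.complete ℂ E

/-- The smooth real manifold underlying a complex manifold. -/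
instance instIsManifoldReal [IsManifold 𝓘(ℂ, E) ω M] : IsManifold 𝓘(ℝ, E) ∞ M := by
  refine isManifold_of_contDiffOn _ _ _ fun e e' he he' ↦ ?_
  have h := (contDiffGroupoid ω 𝓘(ℂ, E)).compatible he he'
  rw [contDiffGroupoid, mem_groupoid_of_pregroupoid] at h
  have h1 : ContDiffOn ℂ ω _ _ := h.1
  exact (h1.restrict_scalars ℝ).of_le le_top

variable [FiniteDimensional ℂ E] [IsManifold 𝓘(ℂ, E) ω M]

/-- The complex structure of a complex manifold: multiplication by `i` on the tangent space at `x`,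
which the preferred holomorphic chart at `x` identifies with the complex vector space `E`. -/
def complexStructure (x : M) : TangentSpace 𝓘(ℝ, E) x →L[ℝ] TangentSpace 𝓘(ℝ, E) x :=
  (Complex.I • ContinuousLinearMap.id ℝ E : E →L[ℝ] E)

variable [RiemannianBundle (fun x : M ↦ TangentSpace 𝓘(ℝ, E) x)]

/-- The form `ω(u, v) = g(J u, v)`. -/
def kahlerForm (x : M) (u v : TangentSpace 𝓘(ℝ, E) x) : ℝ :=
  inner ℝ (complexStructure x u) v

/-- The exterior derivative of `ω` evaluated on three vector fields. -/
def extDerivKahlerForm (X Y Z : Π x : M, TangentSpace 𝓘(ℝ, E) x) (x : M) : ℝ :=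
  mvfderiv 𝓘(ℝ, E) (fun y ↦ kahlerForm y (Y y) (Z y)) x (X x)
    - mvfderiv 𝓘(ℝ, E) (fun y ↦ kahlerForm y (X y) (Z y)) x (Y x)
    + mvfderiv 𝓘(ℝ, E) (fun y ↦ kahlerForm y (X y) (Y y)) x (Z x)
    - kahlerForm x (mlieBracket 𝓘(ℝ, E) X Y x) (Z x)
    + kahlerForm x (mlieBracket 𝓘(ℝ, E) X Z x) (Y x)
    - kahlerForm x (mlieBracket 𝓘(ℝ, E) Y Z x) (X x)

variable (E M) in
/-- The Riemannian metric of a complex manifold is Kähler: it is Hermitian, and its fundamental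
form `ω` is closed. -/
structure IsKahler : Prop where
  hermitian : ∀ (x : M) (u v : TangentSpace 𝓘(ℝ, E) x),
    inner ℝ (complexStructure x u) (complexStructure x v) = inner ℝ u v
  closed : ∀ (X Y Z : Π x : M, TangentSpace 𝓘(ℝ, E) x) (x : M),
    DiffAt X x → DiffAt Y x → DiffAt Z x → extDerivKahlerForm X Y Z x = 0

/-- A special Kähler structure: a smooth connection on the real tangent bundle that is flat,
torsion-free, symplectic (`∇ω = 0`), and satisfies `d_∇ J = 0`, where the complex structure `J` is
regarded as a 1-form with values in the tangent bundle, so that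
`(d_∇ J)(X, Y) = ∇_X (J Y) - ∇_Y (J X) - J [X, Y]`. -/
structure IsSpecialKahlerStructure
    (cov : CovariantDerivative 𝓘(ℝ, E) E (fun x : M ↦ TangentSpace 𝓘(ℝ, E) x)) : Prop where
  smooth : cov.ContMDiffCovariantDerivative ∞
  flat : ∀ (x : M) (u v w : TangentSpace 𝓘(ℝ, E) x), curvature cov x u v w = 0
  torsionFree : cov.torsion = 0
  symplectic : ∀ (X Y Z : Π x : M, TangentSpace 𝓘(ℝ, E) x) (x : M),
    DiffAt X x → DiffAt Y x → DiffAt Z x →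
    mvfderiv 𝓘(ℝ, E) (fun y ↦ kahlerForm y (Y y) (Z y)) x (X x)
      = kahlerForm x (cov Y x (X x)) (Z x) + kahlerForm x (Y x) (cov Z x (X x))
  extDeriv_complexStructure : ∀ (X Y : Π x : M, TangentSpace 𝓘(ℝ, E) x) (x : M),
    DiffAt X x → DiffAt Y x →
    cov (fun y ↦ complexStructure y (Y y)) x (X x)
      - cov (fun y ↦ complexStructure y (X y)) x (Y x)
      - complexStructure x (mlieBracket 𝓘(ℝ, E) X Y x) = 0

end Complex

end SpecialKahler

end

noncomputable section

set_option linter.unusedSectionVars false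

/-! ### Complex linearity of tangent coordinates -/

namespace SpecialKahler

variable {E : Type*} [NormedAddCommGroup E] [NormedSpace ℂ E]
  {M : Type*} [TopologicalSpace M] [ChartedSpace E M]

/-! Conjugate the special connection `∇` by `J`: put `∇' Y = J⁻¹ ∇(J Y) = -J ∇(J Y)`. Let `D` be the
average of `∇` and `∇'`, and `A` half of their difference, so that `∇ = D + A` and `∇' = D - A`. The
condition `d_∇ J = 0` says that `∇'` is torsion-free. With `g` Hermitian, `∇ω = 0` says that `∇` and
`∇'` are dual with respect to `g`. Hence `D` is torsion-free and metric, so it is the Levi-Civita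
connection (`leviCivita_eq_conjAverage`). By the same two facts `A` is a tensor with `g(A_u v, w)`
totally symmetric, and `A_u` anticommutes with `J`.

Both `D + A` and `D - A` are flat. In the average of their curvatures the terms linear in `A`
cancel, which leaves `R(u, v) = -[A_u, A_v]` (`riemann_eq`). Tracing, `Ric(v, v) = |A_v|² - tr
A_{A_v v}`, and the trace vanishes because `A_{A_v v}` anticommutes with `J` (`ricci_self_eq`). So
Ricci is nonnegative. The scalar curvature is `|A|²`; if it vanishes then so does `A`, and with it
`R`. -/

theorem complexStructure_complexStructure (x : M) (u : TangentSpace 𝓘(ℝ, E) x) :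
    complexStructure x (complexStructure x u) = -u := by
  change Complex.I • Complex.I • (show E from u) = -(show E from u)
  rw [smul_smul, Complex.I_mul_I, neg_one_smul]

variable [FiniteDimensional ℂ E] [IsManifold 𝓘(ℂ, E) ω M]

/-- The coordinate changes of the real tangent bundle of a complex manifold are complex linear. -/
theorem tangentCoordChange_I_smul {x y z : M} (hx : z ∈ (chartAt E x).source)
    (hy : z ∈ (chartAt E y).source) (v : E) :
    tangentCoordChange 𝓘(ℝ, E) x y z (Complex.I • v)
      = Complex.I • tangentCoordChange 𝓘(ℝ, E) x y z v := by
  have : IsManifold 𝓘(ℂ, E) 1 M := .of_le (n := ω) le_top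
  have h := hasFDerivWithinAt_tangentCoordChange (I := 𝓘(ℂ, E)) (x := x) (y := y) (z := z)
    (by simpa using ⟨hx, hy⟩)
  have hR := hasFDerivWithinAt_tangentCoordChange (I := 𝓘(ℝ, E)) (x := x) (y := y) (z := z)
    (by simpa using ⟨hx, hy⟩)
  -- The real derivative of the holomorphic transition map is its complex derivative with scalars
  -- restricted, by uniqueness of derivatives.
  have h' : HasFDerivAt (extChartAt 𝓘(ℝ, E) y ∘ (extChartAt 𝓘(ℝ, E) x).symm)
      ((tangentCoordChange 𝓘(ℂ, E) x y z).restrictScalars ℝ) (extChartAt 𝓘(ℝ, E) x z) := by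
    simp only [modelWithCornersSelf_coe, Set.range_id, hasFDerivWithinAt_univ] at h
    exact h.restrictScalars ℝ
  simp only [modelWithCornersSelf_coe, Set.range_id, hasFDerivWithinAt_univ] at hR
  rw [hR.unique h']
  simp

theorem trivializationAt_complexStructure {x y : M} (hy : y ∈ (chartAt E x).source)
    (u : TangentSpace 𝓘(ℝ, E) y) :
    (trivializationAt E (TangentSpace 𝓘(ℝ, E)) x ⟨y, complexStructure y u⟩).2
      = Complex.I • (trivializationAt E (TangentSpace 𝓘(ℝ, E)) x ⟨y, u⟩).2 :=
  tangentCoordChange_I_smul (mem_chart_source E y) hy u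

/-- Multiplication by `i` preserves differentiability of vector fields. -/
theorem diffAt_complexStructure {x : M} {Y : Π x : M, TangentSpace 𝓘(ℝ, E) x}
    (hY : DiffAt Y x) : DiffAt (fun y ↦ complexStructure y (Y y)) x := by
  unfold DiffAt at hY ⊢
  rw [mdifferentiableAt_section] at hY ⊢
  refine ((((Complex.I • ContinuousLinearMap.id ℝ E : E →L[ℝ] E)).mdifferentiableAt).comp x
    hY).congr_of_eventuallyEq ?_
  filter_upwards [(chartAt E x).open_source.mem_nhds (mem_chart_source E x)] with y hy
  exact trivializationAt_complexStructure hy (Y y)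

/-- Near the base point, the extension of a tangent vector commutes with multiplication by `i`. -/
theorem complexStructure_extend {x y : M} (hy : y ∈ (chartAt E x).source)
    (w : TangentSpace 𝓘(ℝ, E) x) :
    complexStructure y (FiberBundle.extend E w y)
      = FiberBundle.extend E (complexStructure x w) y := by
  unfold FiberBundle.extend
  rw [trivializationAt_complexStructure (mem_chart_source E x)]
  have hy' : y ∈ (trivializationAt E (TangentSpace 𝓘(ℝ, E)) x).baseSet := hy
  have h := TangentBundle.symmL_trivializationAt_eq_core (I := 𝓘(ℝ, E)) hy
  have h' (a : E) : (trivializationAt E (TangentSpace 𝓘(ℝ, E)) x).symm y a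
      = tangentCoordChange 𝓘(ℝ, E) x y y a := by
    rw [← Trivialization.symmL_apply (R := ℝ) _ hy', h]
    rfl
  rw [h', h']
  exact (tangentCoordChange_I_smul hy (mem_chart_source E y) _).symm

end SpecialKahler

/-! ### Smooth extensions of tangent vectors -/

section

variable {E : Type*} [NormedAddCommGroup E] [NormedSpace ℝ E] [FiniteDimensional ℝ E]
  {M : Type*} [TopologicalSpace M] [T2Space M] [ChartedSpace E M] [IsManifold 𝓘(ℝ, E) ∞ M]

/-- Every tangent vector has a globally smooth extension that agrees near the base point with
`FiberBundle.extend`. -/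
theorem exists_contMDiff_eventuallyEq_extend {x : M} (w : TangentSpace 𝓘(ℝ, E) x) :
    ∃ σ : Π x : M, TangentSpace 𝓘(ℝ, E) x, CMDiff ∞ (T% σ) ∧
      ∀ᶠ y in nhds x, σ y = FiberBundle.extend E w y := by
  obtain ⟨s, hs, h⟩ := FiberBundle.exists_contMDiffOn_extend (k := ∞) 𝓘(ℝ, E) E w
  obtain ⟨f, -, hf⟩ := (SmoothBumpFunction.nhds_basis_tsupport (I := 𝓘(ℝ, E)) x).mem_iff.1
    (interior_mem_nhds.2 hs)
  refine ⟨fun y ↦ f y • FiberBundle.extend E w y, ?_, ?_⟩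
  · exact ContMDiffOn.smul_section_of_tsupport (u := interior s) (ψ := f) f.contMDiff.contMDiffOn
      isOpen_interior hf (h.mono interior_subset)
  · filter_upwards [f.eventuallyEq_one] with y hy
    simp [hy]

/-- The derivative of `FiberBundle.extend E w` along `FiberBundle.extend E v` is differentiable. -/
theorem mdifferentiableAt_cov_extend
    (cov : CovariantDerivative 𝓘(ℝ, E) E (fun x : M ↦ TangentSpace 𝓘(ℝ, E) x))
    (hcov : cov.ContMDiffCovariantDerivative ∞) {x : M} (v w : TangentSpace 𝓘(ℝ, E) x) :
    -- Smoothness of the connection is applied to a globally smooth section `σ`; locality of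
    -- covariant derivatives then carries the result over to `FiberBundle.extend E w` near `x`.
    MDiffAt (T% (fun y ↦ cov (FiberBundle.extend E w) y (FiberBundle.extend E v y))) x := by
  obtain ⟨σ, hσ, hσw⟩ := exists_contMDiff_eventuallyEq_extend w
  have h1 := (hcov.contMDiff.contMDiff (σ := σ) hσ.contMDiffOn).contMDiffAt Filter.univ_mem (x := x)
  have h2 := h1.clm_bundle_apply
    (FiberBundle.contMDiffAt_extend (k := ∞) 𝓘(ℝ, E) E v)
  refine (h2.mdifferentiableAt (by simp)).congr_of_eventuallyEq ?_
  obtain ⟨s, hs, hd⟩ := FiberBundle.exists_contMDiffOn_extend (k := ∞) 𝓘(ℝ, E) E w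
  filter_upwards [hσw.eventually_nhds, eventually_mem_nhds_iff.2 hs] with y hy hys
  congr 2
  exact cov.isCovariantDerivativeOnUniv.congr_of_eventuallyEq
    ((hd.contMDiffAt hys).mdifferentiableAt (by simp))
    ((hσ y).mdifferentiableAt (by simp)) Filter.univ_mem (hy.mono fun _ h ↦ h.symm)

end

/-! ### Conjugating the connection by the complex structure -/

namespace SpecialKahler

variable {E : Type*} [NormedAddCommGroup E] [NormedSpace ℂ E] [FiniteDimensional ℂ E]
  {M : Type*} [TopologicalSpace M] [ChartedSpace E M] [IsManifold 𝓘(ℂ, E) ω M]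

section Conjugation

theorem diffAt_extend {x : M} (v : TangentSpace 𝓘(ℝ, E) x) :
    DiffAt (FiberBundle.extend E v : Π y : M, TangentSpace 𝓘(ℝ, E) y) x :=
  FiberBundle.mdifferentiableAt_extend ..

theorem DiffAt.add {x : M} {X Y : Π x : M, TangentSpace 𝓘(ℝ, E) x}
    (hX : DiffAt X x) (hY : DiffAt Y x) : DiffAt (X + Y) x :=
  mdifferentiableAt_add_section hX hY

theorem DiffAt.const_smul {x : M} {X : Π x : M, TangentSpace 𝓘(ℝ, E) x} (c : ℝ)
    (hX : DiffAt X x) : DiffAt (c • X) x :=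
  MDifferentiableAt.smul_section (mdifferentiableAt_const (c := c)) hX

variable (cov : CovariantDerivative 𝓘(ℝ, E) E (fun x : M ↦ TangentSpace 𝓘(ℝ, E) x))

theorem cov_smul_add_smul {x : M} {X Y : Π x : M, TangentSpace 𝓘(ℝ, E) x} (a b : ℝ)
    (hX : DiffAt X x) (hY : DiffAt Y x) :
    cov (a • X + b • Y) x = a • cov X x + b • cov Y x := by
  rw [cov.isCovariantDerivativeOnUniv.add (hX.const_smul a) (hY.const_smul b),
    cov.isCovariantDerivativeOnUniv.smul_const a hX,
    cov.isCovariantDerivativeOnUniv.smul_const b hY]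

theorem cov_complexStructure_complexStructure {x : M} {Y : Π x : M, TangentSpace 𝓘(ℝ, E) x}
    (hY : DiffAt Y x) :
    cov (fun y ↦ complexStructure y (complexStructure y (Y y))) x = -cov Y x := by
  have h : (fun y ↦ complexStructure y (complexStructure y (Y y))) = (-1 : ℝ) • Y := by
    funext y
    simp [complexStructure_complexStructure]
  rw [h, cov.isCovariantDerivativeOnUniv.smul_const _ hY, neg_one_smul]

/-- The average of `∇Y` and of its conjugate `J⁻¹ ∇(JY)` under the complex structure. -/
def conjAverage (Y : Π x : M, TangentSpace 𝓘(ℝ, E) x) (x : M) :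
    TangentSpace 𝓘(ℝ, E) x →L[ℝ] TangentSpace 𝓘(ℝ, E) x :=
  (1 / 2 : ℝ) • (cov Y x - (complexStructure x).comp (cov (fun y ↦ complexStructure y (Y y)) x))

/-- Half the difference of `∇Y` and of its conjugate `J⁻¹ ∇(JY)` under the complex structure. -/
def conjDifference (Y : Π x : M, TangentSpace 𝓘(ℝ, E) x) (x : M) :
    TangentSpace 𝓘(ℝ, E) x →L[ℝ] TangentSpace 𝓘(ℝ, E) x :=
  (1 / 2 : ℝ) • (cov Y x + (complexStructure x).comp (cov (fun y ↦ complexStructure y (Y y)) x))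

theorem conjAverage_apply (Y : Π x : M, TangentSpace 𝓘(ℝ, E) x) (x : M)
    (u : TangentSpace 𝓘(ℝ, E) x) :
    conjAverage cov Y x u = (1 / 2 : ℝ) •
      (cov Y x u - complexStructure x (cov (fun y ↦ complexStructure y (Y y)) x u)) := rfl

theorem conjDifference_apply (Y : Π x : M, TangentSpace 𝓘(ℝ, E) x) (x : M)
    (u : TangentSpace 𝓘(ℝ, E) x) :
    conjDifference cov Y x u = (1 / 2 : ℝ) •
      (cov Y x u + complexStructure x (cov (fun y ↦ complexStructure y (Y y)) x u)) := rfl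

/-- Since `∇(J Y) = J ∇' Y` and `∇'(J Y) = J ∇ Y`, passing from `Y` to `J Y` exchanges the two
connections, so their difference changes sign. -/
theorem conjDifference_complexStructure {x : M} {Y : Π x : M, TangentSpace 𝓘(ℝ, E) x}
    (hY : DiffAt Y x) (u : TangentSpace 𝓘(ℝ, E) x) :
    conjDifference cov (fun y ↦ complexStructure y (Y y)) x u
      = -complexStructure x (conjDifference cov Y x u) := by
  rw [conjDifference_apply, conjDifference_apply, cov_complexStructure_complexStructure cov hY,
    neg_apply, map_smul, map_add, map_neg, complexStructure_complexStructure]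
  module

end Conjugation

variable [RiemannianBundle (fun x : M ↦ TangentSpace 𝓘(ℝ, E) x)]
  {cov : CovariantDerivative 𝓘(ℝ, E) E (fun x : M ↦ TangentSpace 𝓘(ℝ, E) x)}

theorem IsKahler.inner_complexStructure_left (hM : IsKahler E M) {x : M}
    (u v : TangentSpace 𝓘(ℝ, E) x) :
    inner ℝ (complexStructure x u) v = -inner ℝ u (complexStructure x v) := by
  rw [← hM.hermitian x u, complexStructure_complexStructure, inner_neg_right, neg_neg]

namespace IsSpecialKahlerStructure

variable {x : M} {X Y Z : Π x : M, TangentSpace 𝓘(ℝ, E) x}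

theorem cov_sub_cov (hcov : IsSpecialKahlerStructure cov) (hX : DiffAt X x) (hY : DiffAt Y x) :
    cov Y x (X x) - cov X x (Y x) = mlieBracket 𝓘(ℝ, E) X Y x :=
  cov.torsion_eq_zero_iff.1 hcov.torsionFree hX hY

/-- Applying `J` to `d_∇ J = 0` shows that `∇'` is torsion-free; so is its average with `∇`. -/
theorem conjAverage_sub_conjAverage (hcov : IsSpecialKahlerStructure cov)
    (hX : DiffAt X x) (hY : DiffAt Y x) :
    conjAverage cov Y x (X x) - conjAverage cov X x (Y x) = mlieBracket 𝓘(ℝ, E) X Y x := by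
  have h := congrArg (complexStructure x) (hcov.extDeriv_complexStructure X Y x hX hY)
  rw [map_sub, map_sub, complexStructure_complexStructure, map_zero,
    ← hcov.cov_sub_cov hX hY] at h
  rw [← hcov.cov_sub_cov hX hY, conjAverage_apply, conjAverage_apply]
  linear_combination (norm := module) (-(1 / 2 : ℝ)) • h

/-- Two connections with the same torsion differ by a symmetric tensor. -/
theorem conjDifference_comm (hcov : IsSpecialKahlerStructure cov)
    (hX : DiffAt X x) (hY : DiffAt Y x) :
    conjDifference cov Y x (X x) = conjDifference cov X x (Y x) := by
  have h := congrArg (complexStructure x) (hcov.extDeriv_complexStructure X Y x hX hY)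
  rw [map_sub, map_sub, complexStructure_complexStructure, map_zero,
    ← hcov.cov_sub_cov hX hY] at h
  rw [conjDifference_apply, conjDifference_apply]
  linear_combination (norm := module) ((1 / 2 : ℝ)) • h

/-- Duality of `∇` and `∇'`: this is `∇ω = 0` evaluated on `Y` and `J Z`, because `ω(Y, J Z) = g(Y,
Z)`. Exchanging `Y` and `Z`, then adding or subtracting, gives the next two lemmas. -/
theorem mvfderiv_inner (hM : IsKahler E M) (hcov : IsSpecialKahlerStructure cov)
    (hX : DiffAt X x) (hY : DiffAt Y x) (hZ : DiffAt Z x) :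
    mvfderiv 𝓘(ℝ, E) (fun y ↦ inner ℝ (Y y) (Z y)) x (X x)
      = inner ℝ (cov Y x (X x)) (Z x)
        - inner ℝ (Y x) (complexStructure x (cov (fun y ↦ complexStructure y (Z y)) x (X x))) := by
  have h := hcov.symplectic X Y _ x hX hY (diffAt_complexStructure hZ)
  simp only [kahlerForm, hM.hermitian] at h
  rw [h, hM.inner_complexStructure_left (Y x)]
  ring

theorem mvfderiv_inner_eq_conjAverage (hM : IsKahler E M) (hcov : IsSpecialKahlerStructure cov)
    (hX : DiffAt X x) (hY : DiffAt Y x) (hZ : DiffAt Z x) :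
    mvfderiv 𝓘(ℝ, E) (fun y ↦ inner ℝ (Y y) (Z y)) x (X x)
      = inner ℝ (conjAverage cov Y x (X x)) (Z x) + inner ℝ (Y x) (conjAverage cov Z x (X x)) := by
  have h1 := hcov.mvfderiv_inner hM hX hY hZ
  have h2 := hcov.mvfderiv_inner hM hX hZ hY
  simp only [conjAverage_apply, real_inner_smul_left, real_inner_smul_right, inner_sub_left,
    inner_sub_right]
  simp only [real_inner_comm (Y _) (Z _), real_inner_comm (Y x), real_inner_comm (Z x)] at h1 h2 ⊢
  linarith

theorem inner_conjDifference_comm (hM : IsKahler E M) (hcov : IsSpecialKahlerStructure cov)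
    (hX : DiffAt X x) (hY : DiffAt Y x) (hZ : DiffAt Z x) :
    inner ℝ (conjDifference cov Y x (X x)) (Z x) = inner ℝ (Y x) (conjDifference cov Z x (X x)) := by
  have h1 := hcov.mvfderiv_inner hM hX hY hZ
  have h2 := hcov.mvfderiv_inner hM hX hZ hY
  simp only [conjDifference_apply, real_inner_smul_left, real_inner_smul_right, inner_add_left,
    inner_add_right]
  simp only [real_inner_comm (Y _) (Z _), real_inner_comm (Y x), real_inner_comm (Z x)] at h1 h2 ⊢
  linarith

variable [IsContMDiffRiemannianBundle 𝓘(ℝ, E) ∞ E (fun x : M ↦ TangentSpace 𝓘(ℝ, E) x)]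

/-- The Levi-Civita connection of a special Kähler manifold is the average of the special
connection and of its conjugate. -/
theorem leviCivita_eq_conjAverage (hM : IsKahler E M) (hcov : IsSpecialKahlerStructure cov)
    (hY : DiffAt Y x) : leviCivita E M Y x = conjAverage cov Y x := by
  refine ext_of_extend fun X Z hX hZ ↦ ?_
  -- Koszul's uniqueness argument: the average is metric and torsion-free, so it satisfies the
  -- Koszul formula.
  refine (inner_leviCivitaFun hX hY hZ).trans ?_
  rw [koszul, hcov.mvfderiv_inner_eq_conjAverage hM hX hY hZ,
    hcov.mvfderiv_inner_eq_conjAverage hM hY hZ hX, hcov.mvfderiv_inner_eq_conjAverage hM hZ hX hY,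
    ← hcov.conjAverage_sub_conjAverage hX hY, ← hcov.conjAverage_sub_conjAverage hX hZ,
    ← hcov.conjAverage_sub_conjAverage hY hZ]
  rw [inner_sub_left, inner_sub_left, inner_sub_left]
  simp only [real_inner_comm (X x), real_inner_comm (Y x), real_inner_comm (Z x)]
  ring

end IsSpecialKahlerStructure

end SpecialKahler

/-! ### Traces of endomorphisms anticommuting with a complex structure -/

section

variable {V : Type*} [NormedAddCommGroup V] [InnerProductSpace ℝ V] {ι : Type*} [Fintype ι]

/-- An endomorphism that anticommutes with a complex structure is traceless. -/
theorem OrthonormalBasis.sum_inner_eq_zero_of_anticomm (b : OrthonormalBasis ι ℝ V)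
    (A J : V →ₗ[ℝ] V) (hJ : ∀ v, J (J v) = -v) (hA : ∀ v, A (J v) = -J (A v)) :
    ∑ i, inner ℝ (A (b i)) (b i) = 0 := by
  have h1 : A = J * (A * J) := by
    ext v
    simp [hA, hJ]
  have h2 : A * J * J = -A := by
    ext v
    simp [hJ]
  -- Cyclicity of the trace turns `tr A = tr (J A J)` into `tr A = tr (A J J) = -tr A`.
  have h3 := congrArg (LinearMap.trace ℝ V) h1
  rw [LinearMap.trace_mul_comm, h2, map_neg] at h3
  have h4 : LinearMap.trace ℝ V A = 0 := by linarith
  rw [LinearMap.trace_eq_sum_inner A b] at h4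
  simpa only [real_inner_comm] using h4

end

/-! ### The difference tensor and the curvature -/

namespace SpecialKahler

variable {E : Type*} [NormedAddCommGroup E] [NormedSpace ℂ E] [FiniteDimensional ℂ E]
  {M : Type*} [TopologicalSpace M] [ChartedSpace E M] [IsManifold 𝓘(ℂ, E) ω M]

/-- The tensor underlying `conjDifference`. For a special Kähler structure it is the difference
between the special connection and the Levi-Civita connection. -/
def differenceTensor (cov : CovariantDerivative 𝓘(ℝ, E) E (fun x : M ↦ TangentSpace 𝓘(ℝ, E) x))
    {x : M} (v : TangentSpace 𝓘(ℝ, E) x) : TangentSpace 𝓘(ℝ, E) x →L[ℝ] TangentSpace 𝓘(ℝ, E) x :=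
  conjDifference cov (FiberBundle.extend E v) x

variable [RiemannianBundle (fun x : M ↦ TangentSpace 𝓘(ℝ, E) x)]
  {cov : CovariantDerivative 𝓘(ℝ, E) E (fun x : M ↦ TangentSpace 𝓘(ℝ, E) x)}

namespace IsSpecialKahlerStructure

variable {x : M} {Y : Π x : M, TangentSpace 𝓘(ℝ, E) x}

theorem differenceTensor_comm (hcov : IsSpecialKahlerStructure cov)
    (u v : TangentSpace 𝓘(ℝ, E) x) : differenceTensor cov u v = differenceTensor cov v u := by
  have h := hcov.conjDifference_comm (diffAt_extend v) (diffAt_extend u)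
  simpa only [differenceTensor, FiberBundle.extend_apply_self] using h

/-- Tensoriality comes from symmetry: exchanging the arguments moves `Y` into the direction slot,
where only its value at `x` matters. -/
theorem conjDifference_eq (hcov : IsSpecialKahlerStructure cov) (hY : DiffAt Y x)
    (u : TangentSpace 𝓘(ℝ, E) x) :
    conjDifference cov Y x u = differenceTensor cov u (Y x) := by
  have h := hcov.conjDifference_comm (diffAt_extend u) hY
  simpa only [differenceTensor, FiberBundle.extend_apply_self] using h

/-- Together with `differenceTensor_comm`, this makes `g(A_u v, w)` a totally symmetric cubic form.
-/
theorem inner_differenceTensor_comm (hM : IsKahler E M) (hcov : IsSpecialKahlerStructure cov)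
    (u v w : TangentSpace 𝓘(ℝ, E) x) :
    inner ℝ (differenceTensor cov u v) w = inner ℝ v (differenceTensor cov u w) := by
  have h := hcov.inner_conjDifference_comm hM (diffAt_extend u) (diffAt_extend v) (diffAt_extend w)
  rw [hcov.conjDifference_eq (diffAt_extend v), hcov.conjDifference_eq (diffAt_extend w)] at h
  simpa only [FiberBundle.extend_apply_self] using h

theorem differenceTensor_complexStructure (hcov : IsSpecialKahlerStructure cov)
    (u v : TangentSpace 𝓘(ℝ, E) x) :
    differenceTensor cov u (complexStructure x v)
      = -complexStructure x (differenceTensor cov u v) := by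
  have h := conjDifference_complexStructure cov (diffAt_extend v) u
  rw [hcov.conjDifference_eq (diffAt_complexStructure (diffAt_extend v)),
    hcov.conjDifference_eq (diffAt_extend v)] at h
  simpa only [FiberBundle.extend_apply_self] using h

variable [T2Space M]

theorem diffAt_cov_extend (hcov : IsSpecialKahlerStructure cov) (v w : TangentSpace 𝓘(ℝ, E) x) :
    DiffAt (fun y ↦ cov (FiberBundle.extend E w) y (FiberBundle.extend E v y)) x :=
  mdifferentiableAt_cov_extend cov hcov.smooth v w

theorem eventually_diffAt_extend (w : TangentSpace 𝓘(ℝ, E) x) :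
    ∀ᶠ y in nhds x, DiffAt (FiberBundle.extend E w : Π y : M, TangentSpace 𝓘(ℝ, E) y) y := by
  obtain ⟨s, hs, hd⟩ := FiberBundle.exists_contMDiffOn_extend (k := ∞) 𝓘(ℝ, E) E w
  filter_upwards [eventually_mem_nhds_iff.2 hs] with y hy
  exact (hd.contMDiffAt hy).mdifferentiableAt (by simp)

/-- Rewrites `∇'` of an extension through the extension of `J w`, so that flatness of `∇` at the
vector `J w` can be used. -/
theorem eventually_cov_complexStructure_extend
    (cov : CovariantDerivative 𝓘(ℝ, E) E (fun x : M ↦ TangentSpace 𝓘(ℝ, E) x))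
    (w : TangentSpace 𝓘(ℝ, E) x) :
    ∀ᶠ y in nhds x, cov (fun z ↦ complexStructure z (FiberBundle.extend E w z)) y
      = cov (FiberBundle.extend E (complexStructure x w)) y := by
  filter_upwards [eventually_diffAt_extend w, eventually_diffAt_extend (complexStructure x w),
    (chartAt E x).open_source.mem_nhds (mem_chart_source E x)] with y h1 h2 hy
  refine cov.isCovariantDerivativeOnUniv.congr_of_eventuallyEq (diffAt_complexStructure h1) h2
    Filter.univ_mem ?_
  filter_upwards [(chartAt E x).open_source.mem_nhds hy] with z hz
  exact complexStructure_extend hz w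

variable [IsContMDiffRiemannianBundle 𝓘(ℝ, E) ∞ E (fun x : M ↦ TangentSpace 𝓘(ℝ, E) x)]

/-- The right side is the average of `∇_u ∇_v w` and `∇'_u ∇'_v w`, the inner factors of `J` in the
latter cancelling. Expanding `∇ = D + A` and `∇' = D - A`, the mixed terms drop out and `D_u D_v w +
A_u A_v w` remains; no derivative of `A` is needed. -/
theorem leviCivita_leviCivita_add_differenceTensor (hM : IsKahler E M)
    (hcov : IsSpecialKahlerStructure cov) (u v w : TangentSpace 𝓘(ℝ, E) x) :
    leviCivita E M (fun y ↦ leviCivita E M (FiberBundle.extend E w) y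
        (FiberBundle.extend E v y)) x u
      + differenceTensor cov u (differenceTensor cov v w)
    = (1 / 2 : ℝ) •
      (cov (fun y ↦ cov (FiberBundle.extend E w) y (FiberBundle.extend E v y)) x u
        - complexStructure x (cov (fun y ↦ cov (FiberBundle.extend E (complexStructure x w)) y
          (FiberBundle.extend E v y)) x u)) := by
  set P := fun y ↦ cov (FiberBundle.extend E w) y (FiberBundle.extend E v y) with hP
  set Q := fun y ↦ cov (FiberBundle.extend E (complexStructure x w)) y
    (FiberBundle.extend E v y) with hQ
  set JP := fun y ↦ complexStructure y (P y) with hJP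
  set JQ := fun y ↦ complexStructure y (Q y) with hJQ
  have dP : DiffAt P x := hcov.diffAt_cov_extend v w
  have dQ : DiffAt Q x := hcov.diffAt_cov_extend v (complexStructure x w)
  have dJP : DiffAt JP x := diffAt_complexStructure dP
  have dJQ : DiffAt JQ x := diffAt_complexStructure dQ
  -- `S` represents `D_v w` and must do so near `x`, since it is differentiated as a Levi-Civita
  -- derivative. `T` represents `A_v w`, for which the value at `x` suffices by tensoriality.
  set S : Π y : M, TangentSpace 𝓘(ℝ, E) y := (1 / 2 : ℝ) • P + (-(1 / 2) : ℝ) • JQ with hS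
  set T : Π y : M, TangentSpace 𝓘(ℝ, E) y := (1 / 2 : ℝ) • P + (1 / 2 : ℝ) • JQ with hT
  have dS : DiffAt S x := (dP.const_smul _).add (dJQ.const_smul _)
  have dT : DiffAt T x := (dP.const_smul _).add (dJQ.const_smul _)
  have hJS : (fun y ↦ complexStructure y (S y)) = (1 / 2 : ℝ) • JP + (1 / 2 : ℝ) • Q := by
    funext y
    simp [hS, hJP, hJQ, complexStructure_complexStructure]
  have hJT : (fun y ↦ complexStructure y (T y)) = (1 / 2 : ℝ) • JP + (-(1 / 2) : ℝ) • Q := by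
    funext y
    simp [hT, hJP, hJQ, complexStructure_complexStructure]
  have hTx : T x = differenceTensor cov v w := by
    rw [hcov.differenceTensor_comm, differenceTensor, conjDifference_apply,
      (eventually_cov_complexStructure_extend cov w).self_of_nhds]
    simp [hT, hP, hJQ, hQ]
  have hev : ∀ᶠ y in nhds x, S y = leviCivita E M (FiberBundle.extend E w) y
      (FiberBundle.extend E v y) := by
    filter_upwards [eventually_diffAt_extend w, eventually_cov_complexStructure_extend cov w]
      with y h1 h2
    rw [hcov.leviCivita_eq_conjAverage hM h1, conjAverage_apply, h2]
    simp only [hS, hP, hJQ, hQ, Pi.add_apply, Pi.smul_apply]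
    module
  have h1 : leviCivita E M (fun y ↦ leviCivita E M (FiberBundle.extend E w) y
      (FiberBundle.extend E v y)) x = leviCivita E M S x :=
    ((leviCivita E M).isCovariantDerivativeOnUniv.congr_of_eventuallyEq dS
      (dS.congr_of_eventuallyEq (hev.mono fun y h ↦ by simp only [h])) Filter.univ_mem hev).symm
  rw [h1, hcov.leviCivita_eq_conjAverage hM dS, ← hTx, ← hcov.conjDifference_eq dT,
    conjAverage_apply, conjDifference_apply, hJS, hJT, hS, hT, cov_smul_add_smul cov _ _ dP dJQ,
    cov_smul_add_smul cov _ _ dP dJQ, cov_smul_add_smul cov _ _ dJP dQ,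
    cov_smul_add_smul cov _ _ dJP dQ]
  simp only [add_apply, smul_apply, map_add, map_smul]
  module

/-- The curvature of a special Kähler manifold is minus the commutator of the difference tensor. -/
theorem riemann_eq (hM : IsKahler E M) (hcov : IsSpecialKahlerStructure cov)
    (u v w : TangentSpace 𝓘(ℝ, E) x) :
    riemann E x u v w = differenceTensor cov v (differenceTensor cov u w)
      - differenceTensor cov u (differenceTensor cov v w) := by
  have h1 := hcov.leviCivita_leviCivita_add_differenceTensor hM u v w
  have h2 := hcov.leviCivita_leviCivita_add_differenceTensor hM v u w
  have h3 := hcov.flat x u v w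
  have h4 := congrArg (complexStructure x) (hcov.flat x u v (complexStructure x w))
  have h5 := congrArg (fun A ↦ A (mlieBracket 𝓘(ℝ, E) (FiberBundle.extend E u)
    (FiberBundle.extend E v : Π y : M, TangentSpace 𝓘(ℝ, E) y) x))
    (hcov.leviCivita_eq_conjAverage hM (diffAt_extend w))
  simp only [conjAverage_apply, (eventually_cov_complexStructure_extend cov w).self_of_nhds] at h5
  simp only [curvature, curvatureField, FiberBundle.extend_apply_self, map_sub, map_zero] at h3 h4
  simp only [riemann, curvature, curvatureField, FiberBundle.extend_apply_self]
  rw [h5]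
  -- Antisymmetrise the second-derivative identity in `u, v`. The terms `h3` and `-h4` are the
  -- curvatures of `∇` and `∇'`, and `h5` has matched the bracket term with the average of theirs.
  linear_combination (norm := module) h1 - h2 + (1 / 2 : ℝ) • h3 - (1 / 2 : ℝ) • h4

/-- `Ric(v, v)` is the squared Hilbert-Schmidt norm of the difference tensor at `v`. -/
theorem ricci_self_eq (hM : IsKahler E M) (hcov : IsSpecialKahlerStructure cov)
    (v : TangentSpace 𝓘(ℝ, E) x) :
    ricci E x v v = ∑ i, ‖differenceTensor cov v (orthoFrame x i)‖ ^ 2 := by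
  have h := (orthoFrame x).sum_inner_eq_zero_of_anticomm
    (differenceTensor cov (differenceTensor cov v v)).toLinearMap (complexStructure x).toLinearMap
    (complexStructure_complexStructure x)
    (hcov.differenceTensor_complexStructure (differenceTensor cov v v))
  -- The zero subtracted is `tr A_{A_v v}`, which allows the two sums to be compared term by term.
  rw [ricci, ← sub_zero (∑ i, ‖differenceTensor cov v (orthoFrame x i)‖ ^ 2), ← h,
    ← Finset.sum_sub_distrib]
  refine Finset.sum_congr rfl fun i _ ↦ ?_
  rw [hcov.riemann_eq hM, inner_sub_left, hcov.inner_differenceTensor_comm hM v,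
    hcov.differenceTensor_comm _ v, real_inner_self_eq_norm_sq,
    hcov.differenceTensor_comm _ (differenceTensor cov v v)]
  rfl

theorem ricci_self_nonneg (hM : IsKahler E M) (hcov : IsSpecialKahlerStructure cov)
    (v : TangentSpace 𝓘(ℝ, E) x) : 0 ≤ ricci E x v v := by
  rw [hcov.ricci_self_eq hM]
  positivity

theorem differenceTensor_eq_zero (hM : IsKahler E M) (hcov : IsSpecialKahlerStructure cov)
    (hx : scalarCurvature E x = 0) (u v : TangentSpace 𝓘(ℝ, E) x) :
    differenceTensor cov u v = 0 := by
  -- A vanishing sum of nonnegative Ricci terms, each itself a sum of squares, kills `A` on every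
  -- pair of frame vectors; bilinearity does the rest.
  have h1 := (Finset.sum_eq_zero_iff_of_nonneg fun i _ ↦ hcov.ricci_self_nonneg hM _).1 hx
  have h2 (i j) : differenceTensor cov (orthoFrame x i) (orthoFrame x j) = 0 := by
    have h := h1 i (Finset.mem_univ i)
    rw [hcov.ricci_self_eq hM, Finset.sum_eq_zero_iff_of_nonneg fun _ _ ↦ by positivity] at h
    simpa using h j (Finset.mem_univ j)
  have h3 (i) : differenceTensor cov (orthoFrame x i) u = 0 := by
    rw [← (orthoFrame x).sum_repr u, map_sum]
    exact Finset.sum_eq_zero fun j _ ↦ by rw [map_smul, h2, smul_zero]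
  rw [← (orthoFrame x).sum_repr v, map_sum]
  exact Finset.sum_eq_zero fun j _ ↦ by rw [map_smul, hcov.differenceTensor_comm, h3, smul_zero]

end IsSpecialKahlerStructure

end SpecialKahler

end

theorem mainTheorem1 {E : Type*} [NormedAddCommGroup E] [NormedSpace ℂ E] [FiniteDimensional ℂ E]
    {M : Type*} [TopologicalSpace M] [T2Space M] [ChartedSpace E M] [IsManifold 𝓘(ℂ, E) ω M]
    [RiemannianBundle (fun x : M ↦ TangentSpace 𝓘(ℝ, E) x)]
    [IsContMDiffRiemannianBundle 𝓘(ℝ, E) ∞ E (fun x : M ↦ TangentSpace 𝓘(ℝ, E) x)]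
    (hM : SpecialKahler.IsKahler E M)
    (cov : CovariantDerivative 𝓘(ℝ, E) E (fun x : M ↦ TangentSpace 𝓘(ℝ, E) x))
    (hcov : SpecialKahler.IsSpecialKahlerStructure cov) :
    (∀ (x : M) (v : TangentSpace 𝓘(ℝ, E) x), 0 ≤ SpecialKahler.ricci E x v v) ∧
    ((∀ x : M, SpecialKahler.scalarCurvature E x = 0) →
      ∀ (x : M) (u v w : TangentSpace 𝓘(ℝ, E) x), SpecialKahler.riemann E x u v w = 0) := by
  refine ⟨fun x v ↦ hcov.ricci_self_nonneg hM v, fun h x u v w ↦ ?_⟩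
  rw [hcov.riemann_eq hM]
  simp only [hcov.differenceTensor_eq_zero hM (h x), sub_zero]
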